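/- Let $\tau=\tau_1+i\tau_2$ with $\tau_2>0$, let $w,z\in\mathbb C$, and write $\sum^*_{r,\ell}$ for the sum over all $(r,\ell)\in\mathbb Z^2$ for which $w+r\tau+\ell\neq 0$ (respectively $z+r\tau+\ell\ne0$, according to the point that occurs in the summand). For $s\in\mathbb C$ let $$\mathbb E_s(w,z;\tau)=e^{\frac{2\pi i}{\tau_2}\operatorname{Im}(w\overline z)}\int_1^\infty x^{-s}\sum_{r,\ell}{}^{*}\,e^{-\frac{\pi x}{\tau_2}|z+r\tau+\ell|^2+\frac{2\pi i}{\tau_2}\operatorname{Im}((z+r\tau+\ell)\overline w)}\,dx+\int_1^\infty x^{s-1}\sum_{r,\ell}{}^{*}\,e^{-\frac{\pi x}{\tau_2}|w+r\tau+\ell|^2+\frac{2\pi i}{\tau_2}\operatorname{Im}((w+r\tau+\ell)\overline z)}\,dx$$ (for $w,z\notin\mathbb Z\tau+\mathbb Z$ this is the analytic continuation in $s$ of the Kronecker–Eisenstein series $\Gamma(s)(\tau_2/\pi)^s\sum^*_{r,\ell}e^{\frac{2\pi i}{\tau_2}\operatorname{Im}((w+r\tau+\ell)\overline z)}|w+r\tau+\ell|^{-2s}$).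 For $\mu>0$ and $c>0$ put $$\mathcal E_{1,\mu}(w,z;\tau)=\frac1{2\pi i}\int_{c-i\infty}^{c+i\infty}(\pi\mu)^{-s}\,\Gamma(s)\,\mathbb E_{s+1}(w,z;\tau)\,ds .$$ **Proposition.** For all $c>0$ and $\mu>0$ the following hold. (1) For all $w,z\in\mathbb C$ and all $\tau$ with $\tau_2>0$, the integral defining $\mathcal E_{1,\mu}(w,z;\tau)$ converges absolutely, and $$\mathcal E_{1,\mu}(w,z;\tau)=e^{\frac{2\pi i}{\tau_2}\operatorname{Im}(w\overline z)}\sum_{n\ge 0}\frac{(-\pi\mu)^n}{n!}\,\mathbb E_n(z,w;\tau)$$ whenever the power series on the right-hand side converges (as a limit of partial sums). The series converges absolutely whenever $\mu\tau_2<|z+r\tau+\ell|^2$ for all $(r,\ell)\in\mathbb Z^2$ with $z+r\tau+\ell\ne0$. (2) In particular $\mathcal E_{1,\mu}(w,z;\tau)$ is quasiperiodic in $z$: if $w=A\tau+B$ with $A,B\in\mathbb R$, then for all $z\in\mathbb C$ $$\mathcal E_{1,\mu}(w,z+1;\tau)=e^{2\pi iA}\,\mathcal E_{1,\mu}(w,z;\tau),\qquad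 \mathcal E_{1,\mu}(w,z+\tau;\tau)=e^{-2\pi iB}\,\mathcal E_{1,\mu}(w,z;\tau).$$ -/

import Mathlib

open scoped UpperHalfPlane

namespace KroneckerEisenstein

noncomputable section

/-- The lattice point `r τ + ℓ` with `(r, ℓ) ∈ ℤ²`. -/
def latticePoint (τ : ℍ) (p : ℤ × ℤ) : ℂ := (p.1 : ℂ) * (τ : ℂ) + (p.2 : ℂ)

/-- The phase `exp ((2 π i / τ₂) Im (u \bar v))`, where `τ₂ = Im τ`. -/
def phase (τ : ℍ) (u v : ℂ) : ℂ :=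
  Complex.exp (2 * (Real.pi : ℂ) * Complex.I / (τ.im : ℂ)
    * ((u * (starRingEnd ℂ) v).im : ℂ))

/-- The theta sum
`∑* exp (- (π x / τ₂) |w + r τ + ℓ|² + (2 π i / τ₂) Im ((w + r τ + ℓ) \bar z))`,
where the star means that `(r, ℓ)` runs over the pairs in `ℤ²` with `w + r τ + ℓ ≠ 0`. -/
def thetaSum (τ : ℍ) (w z : ℂ) (x : ℝ) : ℂ :=
  ∑' p : {p : ℤ × ℤ // w + latticePoint τ p ≠ 0},
    Complex.exp ((-(Real.pi * x / τ.im * ‖w + latticePoint τ p.1‖ ^ 2) : ℝ) : ℂ)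
      * phase τ (w + latticePoint τ p.1) z

/-- The (completed) Kronecker-Eisenstein series `𝔼_s(w, z; τ)` for all `s ∈ ℂ`, by its integral
representation. -/
def kroneckerE (s w z : ℂ) (τ : ℍ) : ℂ :=
  phase τ w z * (∫ x in Set.Ioi (1 : ℝ), (x : ℂ) ^ (-s) * thetaSum τ z w x)
    + ∫ x in Set.Ioi (1 : ℝ), (x : ℂ) ^ (s - 1) * thetaSum τ w z x

/-- The function `s ↦ Γ(s) 𝔼_{s+1}(w, z; τ)`. -/
def mellinKernel (w z : ℂ) (τ : ℍ) (s : ℂ) : ℂ :=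
  Complex.Gamma s * kroneckerE (s + 1) w z τ

/-- The integrand `(π μ)^{-s} Γ(s) 𝔼_{s+1}(w, z; τ)` of the inverse Mellin transform. -/
def massiveIntegrand (μ : ℝ) (w z : ℂ) (τ : ℍ) (s : ℂ) : ℂ :=
  ((Real.pi * μ : ℝ) : ℂ) ^ (-s) * mellinKernel w z τ s

/-- The massive Kronecker-Eisenstein function
`𝓔_{1,μ}(w, z; τ) = (2 π i)⁻¹ ∫_{c - i∞}^{c + i∞} (π μ)^{-s} Γ(s) 𝔼_{s+1}(w, z; τ) ds`,
the inverse Mellin transform along `Re s = c` of `Γ(s) 𝔼_{s+1}(w, z; τ)`, taken at `π μ`. -/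
def massiveE (c μ : ℝ) (w z : ℂ) (τ : ℍ) : ℂ :=
  mellinInv c (mellinKernel w z τ) (Real.pi * μ)

/-- The `n`-th term `(-π μ)ⁿ / n! · 𝔼_n(z, w; τ)` of the power series in `μ`. -/
def massiveTerm (μ : ℝ) (w z : ℂ) (τ : ℍ) (n : ℕ) : ℂ :=
  (-(Real.pi : ℂ) * (μ : ℂ)) ^ n / (n.factorial : ℂ) * kroneckerE (n : ℂ) z w τ

/-- `f(w, z; τ)` is quasiperiodic in `z`: with `w = A τ + B`, `A, B ∈ ℝ`,
`f(w, z + 1; τ) = e^{2 π i A} f(w, z; τ)` and `f(w, z + τ; τ) = e^{- 2 π i B} f(w, z; τ)`. -/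
def IsQuasiperiodic (f : ℂ → ℂ → ℍ → ℂ) : Prop :=
  ∀ (τ : ℍ) (w z : ℂ) (A B : ℝ), w = (A : ℂ) * (τ : ℂ) + (B : ℂ) →
    f w (z + 1) τ = Complex.exp (2 * (Real.pi : ℂ) * Complex.I * (A : ℂ)) * f w z τ ∧
    f w (z + (τ : ℂ)) τ = Complex.exp (-(2 * (Real.pi : ℂ) * Complex.I * (B : ℂ))) * f w z τ

end

end KroneckerEisenstein

namespace KroneckerEisenstein

open MeasureTheory Filter Topology Set Complex

/-! Since `Γ(s) b^{-s}` has inverse Mellin transform `y ↦ e^{-y b}`, and both halves of `𝔼_{s+1}`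
are superpositions of powers `b^{-s}` (with `b = x` and `b = 1/x`), Fubini turns the contour
integral into two real integrals, one of `θ(z,w,x)/x` against `e^{-πμx}` and one of `θ(w,z,x)`
against `e^{-πμ/x}`. Fubini and absolute convergence both rest on the integrability of `Γ` along
vertical lines and the exponential decay of the theta sums.

Expanding the exponentials produces the two halves of `𝔼_n(z,w)`. The `1/x` half always converges.
The other is the Taylor series of a Laplace transform, absolutely convergent when `πμ` is below the
decay rate `(π/τ₂) min |z+rτ+ℓ|²`. If it converges only conditionally, the identity theorem and
Abel's limit theorem still identify its sum (`eq_integral_of_tendsto_sum`). Quasiperiodicity needs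
no expansion: translating `z` by a lattice point multiplies `𝔼_s`, for every `s`, by the same phase.
-/

/-! ### The Gamma function on vertical lines -/

/-- The bound `|Γ(s)| ≤ Γ(Re s)` in the right half-plane. -/
lemma norm_Gamma_le_Gamma_re {s : ℂ} (hs : 0 < s.re) : ‖Gamma s‖ ≤ Real.Gamma s.re := by
  rw [Gamma_eq_integral hs, Real.Gamma_eq_integral hs, GammaIntegral]
  refine (norm_integral_le_integral_norm _).trans_eq ?_
  refine setIntegral_congr_fun measurableSet_Ioi fun x hx => ?_
  simp only [norm_mul, norm_real, Real.norm_eq_abs, abs_of_pos (Real.exp_pos _),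
    norm_cpow_eq_rpow_re_of_pos (mem_Ioi.mp hx), sub_re, one_re]

lemma continuous_Gamma_vertical {c : ℝ} (hc : 0 < c) :
    Continuous fun t : ℝ => Gamma (c + t * I) := by
  refine continuous_iff_continuousAt.mpr fun t => ?_
  refine ContinuousAt.comp (f := fun t : ℝ => (c + t * I : ℂ)) (g := Gamma) ?_ (by fun_prop)
  refine (differentiableAt_Gamma _ fun m h => ?_).continuousAt
  have := congrArg re h
  simp at this
  linarith [(Nat.cast_nonneg m : (0 : ℝ) ≤ m)]

/-- `Γ` is integrable along each vertical line in the right half-plane. -/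
lemma integrable_Gamma_vertical {c : ℝ} (hc : 0 < c) :
    Integrable fun t : ℝ => Gamma (c + t * I) := by
  have hdom : Integrable fun t : ℝ =>
      (Real.Gamma (c + 2) * max 1 (c ^ 2)⁻¹) * (1 + t ^ 2)⁻¹ :=
    integrable_inv_one_add_sq.const_mul _
  refine hdom.mono' (continuous_Gamma_vertical hc).aestronglyMeasurable (.of_forall fun t => ?_)
  set s : ℂ := c + t * I with hs
  have hre : s.re = c := by simp [hs]
  have him : s.im = t := by simp [hs]
  have hs0 : s ≠ 0 := fun h => by rw [h] at hre; simp at hre; linarith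
  have hs1 : s + 1 ≠ 0 := fun h => by
    have := congrArg re h
    simp [hre] at this
    linarith
  -- Two uses of the functional equation trade the bounded `Γ(s+2)` for decay of order `|s|⁻²`.
  have hfe : Gamma (s + 2) = (s + 1) * s * Gamma s := by
    rw [show s + 2 = (s + 1) + 1 by ring, Gamma_add_one _ hs1, Gamma_add_one _ hs0]; ring
  have hle : ‖s‖ ^ 2 ≤ ‖(s + 1) * s‖ := by
    rw [norm_mul, sq]
    refine mul_le_mul_of_nonneg_right ?_ (norm_nonneg _)
    rw [← sq_le_sq₀ (norm_nonneg _) (norm_nonneg _), Complex.sq_norm, Complex.sq_norm,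
      normSq_apply, normSq_apply]
    simp only [add_re, one_re, add_im, one_im, hre, him]
    nlinarith
  have hG : ‖Gamma (s + 2)‖ ≤ Real.Gamma (c + 2) := by
    have h := norm_Gamma_le_Gamma_re (s := s + 2) (by simp [hre]; linarith)
    simpa [hre] using h
  have hnorm : ‖s‖ ^ 2 = c ^ 2 + t ^ 2 := by
    rw [Complex.sq_norm, normSq_apply, hre, him]; ring
  have hprod : (c ^ 2 + t ^ 2) * ‖Gamma s‖ ≤ Real.Gamma (c + 2) := by
    rw [← hnorm]
    calc ‖s‖ ^ 2 * ‖Gamma s‖ ≤ ‖(s + 1) * s‖ * ‖Gamma s‖ := by gcongr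
      _ = ‖Gamma (s + 2)‖ := by simp only [hfe, norm_mul]
      _ ≤ _ := hG
  have hG0 : 0 ≤ Real.Gamma (c + 2) := (norm_nonneg _).trans hG
  have hc2 : 0 < c ^ 2 := by positivity
  have hmax : 1 + t ^ 2 ≤ max 1 (c ^ 2)⁻¹ * (c ^ 2 + t ^ 2) := by
    have h1 : (c ^ 2)⁻¹ * c ^ 2 ≤ max 1 (c ^ 2)⁻¹ * c ^ 2 := by gcongr; exact le_max_right _ _
    have h2 : 1 * t ^ 2 ≤ max 1 (c ^ 2)⁻¹ * t ^ 2 := by gcongr; exact le_max_left _ _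
    rw [inv_mul_cancel₀ hc2.ne'] at h1
    linarith
  rw [← div_eq_mul_inv, le_div_iff₀ (by positivity)]
  calc ‖Gamma s‖ * (1 + t ^ 2) ≤ ‖Gamma s‖ * (max 1 (c ^ 2)⁻¹ * (c ^ 2 + t ^ 2)) := by gcongr
    _ = max 1 (c ^ 2)⁻¹ * ((c ^ 2 + t ^ 2) * ‖Gamma s‖) := by ring
    _ ≤ max 1 (c ^ 2)⁻¹ * Real.Gamma (c + 2) := by gcongr
    _ = _ := by ring

/-- The Cahen–Mellin integral: the inverse Mellin transform of `Γ` is `x ↦ e^{-x}`. -/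
lemma mellinInv_Gamma {c x : ℝ} (hc : 0 < c) (hx : 0 < x) :
    mellinInv c Gamma x = (Real.exp (-x) : ℂ) := by
  have hline (t : ℝ) : mellin (fun x : ℝ => (Real.exp (-x) : ℂ)) (c + t * I) =
      Gamma (c + t * I) := by
    rw [← GammaIntegral_eq_mellin, Gamma_eq_integral (by simpa using hc)]
  have h := mellinInv_mellin_eq c (fun x : ℝ => (Real.exp (-x) : ℂ)) hx ?_ ?_ (by fun_prop)
  · rw [← h, mellinInv, mellinInv]
    simp only [hline]
  · have := GammaIntegral_convergent (s := c) (by simpa using hc)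
    simpa only [MellinConvergent, smul_eq_mul, mul_comm] using this
  · simpa only [VerticalIntegrable, hline] using integrable_Gamma_vertical hc

/-! ### Inverse Mellin transforms of superpositions -/

section Superposition

variable {ν : Measure ℝ} {a : ℝ → ℂ} {b : ℝ → ℝ} {c y : ℝ}

/-- Splitting `b^{-s} = b^{-c} b^{-it}` shows the integrand to be a product of integrable functions
of `t` and `x`, times a factor of modulus `y^{-c}`. -/
lemma integrable_uncurry_Gamma_mul (hc : 0 < c) (hy : 0 < y) (hbm : Measurable b)
    (hb : ∀ᵐ x ∂ν, 0 < b x) (ha : Integrable (fun x => a x * (b x : ℂ) ^ (-(c : ℂ))) ν) :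
    Integrable (Function.uncurry fun (t x : ℝ) =>
      (y : ℂ) ^ (-(c + t * I : ℂ)) * (Gamma (c + t * I) * (a x * (b x : ℂ) ^ (-(c + t * I : ℂ)))))
      (volume.prod ν) := by
  have hprod := (integrable_Gamma_vertical hc).mul_prod ha
  have hmeas : AEStronglyMeasurable (fun q : ℝ × ℝ =>
      (y : ℂ) ^ (-(c + q.1 * I : ℂ)) * (b q.2 : ℂ) ^ (-(q.1 * I : ℂ))) (volume.prod ν) := by
    refine Measurable.aestronglyMeasurable ?_
    fun_prop
  refine (hprod.bdd_mul (c := y ^ (-c)) hmeas ?_).congr ?_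
  · have h2 : ∀ᵐ q ∂(volume : Measure ℝ).prod ν, 0 < b q.2 :=
      Measure.quasiMeasurePreserving_snd.ae hb
    filter_upwards [h2] with q hq
    rw [norm_mul, norm_cpow_eq_rpow_re_of_pos hy, norm_cpow_eq_rpow_re_of_pos hq]
    simp
  · have h2 : ∀ᵐ q ∂(volume : Measure ℝ).prod ν, 0 < b q.2 :=
      Measure.quasiMeasurePreserving_snd.ae hb
    filter_upwards [h2] with q hq
    have hq' : (b q.2 : ℂ) ≠ 0 := by exact_mod_cast hq.ne'
    rw [Function.uncurry, show (-(c + q.1 * I) : ℂ) = -c + -(q.1 * I) by ring,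
      cpow_add _ _ hq']
    ring

/-- The integrand of the inverse Mellin transform of `Γ(s) ∫ a b^{-s}` is absolutely integrable
along a vertical line. -/
lemma integrable_Gamma_mul_integral [SFinite ν] (hc : 0 < c) (hy : 0 < y) (hbm : Measurable b)
    (hb : ∀ᵐ x ∂ν, 0 < b x) (ha : Integrable (fun x => a x * (b x : ℂ) ^ (-(c : ℂ))) ν) :
    Integrable fun t : ℝ => (y : ℂ) ^ (-(c + t * I : ℂ)) *
      (Gamma (c + t * I) * ∫ x, a x * (b x : ℂ) ^ (-(c + t * I : ℂ)) ∂ν) := by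
  have h := (integrable_uncurry_Gamma_mul hc hy hbm hb ha).integral_prod_left
  simpa only [Function.uncurry, integral_const_mul] using h

/-- The inverse Mellin transform of `Γ(s) ∫ a b^{-s}` is `y ↦ ∫ a e^{-y b}`. -/
lemma mellinInv_Gamma_mul_integral [SFinite ν] (hc : 0 < c) (hy : 0 < y) (hbm : Measurable b)
    (hb : ∀ᵐ x ∂ν, 0 < b x) (ha : Integrable (fun x => a x * (b x : ℂ) ^ (-(c : ℂ))) ν) :
    mellinInv c (fun s => Gamma s * ∫ x, a x * (b x : ℂ) ^ (-s) ∂ν) y =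
      ∫ x, a x * (Real.exp (-(y * b x)) : ℂ) ∂ν := by
  have hswap := integral_integral_swap (integrable_uncurry_Gamma_mul hc hy hbm hb ha)
  simp only [integral_const_mul] at hswap
  rw [mellinInv]
  simp only [smul_eq_mul]
  rw [hswap, ← integral_smul]
  refine integral_congr_ae ?_
  filter_upwards [hb] with x hx
  rw [← mellinInv_Gamma hc (mul_pos hy hx), mellinInv, mul_smul_comm, ← integral_const_mul]
  congr 1
  refine integral_congr_ae (.of_forall fun t => ?_)
  simp only [smul_eq_mul]
  rw [ofReal_mul, mul_cpow_ofReal_nonneg hy.le hx.le]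
  ring

end Superposition

/-! ### Exponential series and Laplace transforms -/

/-- Termwise integration of the exponential series in `∫ a e^{u b}`. -/
lemma hasSum_integral_pow {ν : Measure ℝ} {a : ℝ → ℂ} {b : ℝ → ℝ} {u : ℂ}
    (ha : AEStronglyMeasurable a ν) (hbm : Measurable b) (hb : ∀ᵐ x ∂ν, 0 ≤ b x)
    (hint : Integrable (fun x => ‖a x‖ * Real.exp (‖u‖ * b x)) ν) :
    HasSum (fun n : ℕ => u ^ n / (n.factorial : ℂ) * ∫ x, (b x : ℂ) ^ n * a x ∂ν)
      (∫ x, a x * cexp (u * b x) ∂ν) := by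
  have hsum (x : ℝ) : HasSum (fun n : ℕ => ‖a x‖ * ((‖u‖ * b x) ^ n / (n.factorial : ℝ)))
      (‖a x‖ * Real.exp (‖u‖ * b x)) := by
    rw [Real.exp_eq_exp_ℝ]
    exact (NormedSpace.expSeries_div_hasSum_exp (𝔸 := ℝ) _).mul_left _
  have h := hasSum_integral_of_dominated_convergence (μ := ν)
    (F := fun (n : ℕ) x => a x * ((u * b x) ^ n / (n.factorial : ℂ)))
    (f := fun x => a x * cexp (u * b x))
    (fun n x => ‖a x‖ * ((‖u‖ * b x) ^ n / (n.factorial : ℝ))) (fun n => ?_) (fun n => ?_) ?_ ?_ ?_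
  · convert! h using 2 with n
    rw [← integral_const_mul]
    congr 1 with x
    ring
  · exact ha.mul (Measurable.aestronglyMeasurable (by fun_prop))
  · filter_upwards [hb] with x hx
    simp [abs_of_nonneg hx]
  · exact .of_forall fun x => (hsum x).summable
  · simpa only [(hsum _).tsum_eq] using hint
  · refine .of_forall fun x => ?_
    rw [Complex.exp_eq_exp_ℂ]
    exact (NormedSpace.expSeries_div_hasSum_exp (𝔸 := ℂ) _).mul_left _

section Laplace

variable {a : ℝ → ℂ} {C m : ℝ}

lemma integrableOn_norm_mul_exp (ha : AEStronglyMeasurable a (volume.restrict (Ioi 1)))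
    (hC : ∀ x ∈ Ioi (1 : ℝ), ‖a x‖ ≤ C * Real.exp (-m * x)) {r : ℝ} (hr : r < m) :
    IntegrableOn (fun x => ‖a x‖ * Real.exp (r * x)) (Ioi 1) := by
  refine ((exp_neg_integrableOn_Ioi 1 (sub_pos.mpr hr)).const_mul C).mono'
    (ha.norm.mul (Measurable.aestronglyMeasurable (by fun_prop))) ?_
  filter_upwards [ae_restrict_mem measurableSet_Ioi] with x hx
  rw [Real.norm_of_nonneg (by positivity), show -(m - r) * x = -m * x + r * x by ring,
    Real.exp_add, ← mul_assoc]
  gcongr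
  exact hC x hx

lemma differentiableAt_integral_mul_exp (ha : AEStronglyMeasurable a (volume.restrict (Ioi 1)))
    (hC : ∀ x ∈ Ioi (1 : ℝ), ‖a x‖ ≤ C * Real.exp (-m * x)) {u : ℂ} (hu : u.re < m) :
    DifferentiableAt ℂ (fun u : ℂ => ∫ x in Ioi (1 : ℝ), a x * cexp (u * x)) u := by
  -- Two intermediate rates: `r` bounds a neighbourhood of `u`, and the gap `r' - r` absorbs the
  -- factor `x` coming from the derivative.
  obtain ⟨r, hur, hrm⟩ := exists_between hu
  obtain ⟨r', hrr', hrm'⟩ := exists_between hrm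
  have hnhds : {v : ℂ | v.re < r} ∈ 𝓝 u :=
    (isOpen_lt continuous_re continuous_const).mem_nhds hur
  have hmeas (v : ℂ) : AEStronglyMeasurable (fun x : ℝ => a x * cexp (v * x))
      (volume.restrict (Ioi 1)) :=
    ha.mul (Measurable.aestronglyMeasurable (by fun_prop))
  have hδ : 0 < r' - r := sub_pos.mpr hrr'
  refine (hasDerivAt_integral_of_dominated_loc_of_deriv_le (μ := volume.restrict (Ioi 1))
    (F := fun (v : ℂ) (x : ℝ) => a x * cexp (v * x))
    (F' := fun (v : ℂ) (x : ℝ) => a x * (cexp (v * x) * x))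
    (bound := fun x => (r' - r)⁻¹ * (‖a x‖ * Real.exp (r' * x)))
    hnhds (.of_forall hmeas) ?_ ?_ ?_ ?_ ?_).2.differentiableAt
  · refine (integrableOn_norm_mul_exp ha hC hu).mono' (hmeas u) (.of_forall fun x => ?_)
    simp [Complex.norm_exp]
  · exact ha.mul (Measurable.aestronglyMeasurable (by fun_prop))
  · filter_upwards [ae_restrict_mem measurableSet_Ioi] with x hx v hv
    have hx0 : 0 < x := one_pos.trans hx
    have h1 : x ≤ (r' - r)⁻¹ * Real.exp ((r' - r) * x) := by
      rw [inv_mul_eq_div, le_div_iff₀ hδ]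
      linarith [Real.add_one_le_exp ((r' - r) * x)]
    calc ‖a x * (cexp (v * x) * x)‖ = ‖a x‖ * (Real.exp (v.re * x) * x) := by
          simp [Complex.norm_exp, abs_of_pos hx0]
      _ ≤ ‖a x‖ * (Real.exp (r * x) * ((r' - r)⁻¹ * Real.exp ((r' - r) * x))) := by
          gcongr
      _ = (r' - r)⁻¹ * (‖a x‖ * Real.exp (r' * x)) := by
          rw [show r' * x = r * x + (r' - r) * x by ring, Real.exp_add]; ring
  · exact (integrableOn_norm_mul_exp ha hC hrm').const_mul _
  · refine .of_forall fun x v _ => ?_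
    simpa using (((hasDerivAt_id v).mul_const (x : ℂ)).cexp).const_mul (a x)

/-- If the Taylor series at `0` of the Laplace transform of an exponentially decaying function
converges at a point of the positive half-axis, it converges to the Laplace transform there. -/
lemma eq_integral_of_tendsto_sum (ha : AEStronglyMeasurable a (volume.restrict (Ioi 1)))
    (hC : ∀ x ∈ Ioi (1 : ℝ), ‖a x‖ ≤ C * Real.exp (-m * x)) (hm : 0 < m) {y : ℝ} (hy : 0 < y)
    {S : ℂ} (hS : Tendsto (fun N : ℕ => ∑ n ∈ Finset.range N,
      (-(y : ℂ)) ^ n / (n.factorial : ℂ) * ∫ x in Ioi (1 : ℝ), (x : ℂ) ^ n * a x) atTop (𝓝 S)) :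
    S = ∫ x in Ioi (1 : ℝ), a x * cexp (-(y : ℂ) * x) := by
  -- The variable is rescaled by `y`, so the series converges at `u = 1` and Abel's theorem applies
  -- on the unit disc.
  set k : ℕ → ℂ := fun n =>
    (-(y : ℂ)) ^ n / (n.factorial : ℂ) * ∫ x in Ioi (1 : ℝ), (x : ℂ) ^ n * a x with hk
  set G : ℂ → ℂ := fun u => ∫ x in Ioi (1 : ℝ), a x * cexp (-(y : ℂ) * u * x) with hG
  set f : ℂ → ℂ := fun u => ∑' n, k n * u ^ n with hf
  have hGdiff {u : ℂ} (hu : -m < y * u.re) : DifferentiableAt ℂ G u := by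
    refine DifferentiableAt.comp (f := fun u : ℂ => -(y : ℂ) * u)
      (g := fun u : ℂ => ∫ x in Ioi (1 : ℝ), a x * cexp (u * x)) u ?_ (by fun_prop)
    refine differentiableAt_integral_mul_exp ha hC ?_
    simp
    linarith
  have heq : ∀ t ∈ Ioo (0 : ℝ) 1, f t = G t := by
    intro t ht
    obtain ⟨ρ, htρ, hρ⟩ := exists_between ht.2
    have hρ0 : 0 < ρ := ht.1.trans htρ
    have hkρ : Summable fun n => ‖k n * (ρ : ℂ) ^ n‖ :=
      (summable_powerSeries_of_norm_lt_one hS.cauchySeq (by simpa [abs_of_pos hρ0])).norm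
    have hfdiff : DifferentiableOn ℂ f (Metric.ball 0 ρ) := by
      refine differentiableOn_tsum_of_summable_norm hkρ (fun n => by fun_prop) Metric.isOpen_ball
        fun n u hu => ?_
      rw [norm_mul, norm_mul (k n), norm_pow, norm_pow, norm_real, Real.norm_of_nonneg hρ0.le]
      gcongr
      exact (mem_ball_zero_iff.mp hu).le
    -- A convex set containing `0` and `t` on which both the power series and the Laplace transform
    -- are holomorphic.
    let U : Set ℂ := Metric.ball 0 ρ ∩ {u | -(m / y) < u.re}
    have hhalf : IsOpen {u : ℂ | -(m / y) < u.re} := isOpen_lt continuous_const continuous_re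
    have hUo : IsOpen U := Metric.isOpen_ball.inter hhalf
    have hUc : IsPreconnected U :=
      ((convex_ball 0 ρ).inter (convex_halfSpace_re_gt _)).isPreconnected
    have hmy : 0 < m / y := div_pos hm hy
    have h0 : (0 : ℂ) ∈ U := ⟨by simpa using hρ0, by simpa using hmy⟩
    have htU : (t : ℂ) ∈ U := by
      refine ⟨by simpa [abs_of_pos ht.1] using htρ, ?_⟩
      simp only [mem_ofPred_eq, ofReal_re]
      linarith [ht.1]
    refine AnalyticOnNhd.eqOn_of_preconnected_of_eventuallyEq
      ((hfdiff.mono inter_subset_left).analyticOnNhd hUo)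
      (DifferentiableOn.analyticOnNhd (fun u hu => (hGdiff ?_).differentiableWithinAt) hUo)
      hUc h0 ?_ htU
    · have := hu.2
      simp only [mem_ofPred_eq, ← neg_div, div_lt_iff₀ hy] at this
      linarith
    · filter_upwards [Metric.ball_mem_nhds (0 : ℂ) hmy] with u hu
      have hu' : ‖-(y : ℂ) * u‖ < m := by
        rw [mem_ball_zero_iff, lt_div_iff₀ hy] at hu
        simpa [abs_of_pos hy, mul_comm] using hu
      have := hasSum_integral_pow (b := fun x => x) ha measurable_id
        ((ae_restrict_mem measurableSet_Ioi).mono fun x hx => (one_pos.trans hx).le)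
        (integrableOn_norm_mul_exp ha hC hu')
      rw [hf, hG]
      dsimp only
      rw [← this.tsum_eq]
      congr 1 with n
      rw [hk, mul_pow]
      ring
  -- Abel's limit theorem; `G` is continuous at `1` because `m > 0`.
  have hlim := Complex.tendsto_tsum_powerSeries_nhdsWithin_lt hS
  rw [tendsto_map'_iff] at hlim
  have hG1 : Tendsto (fun t : ℝ => G t) (𝓝[<] 1) (𝓝 (G 1)) := by
    have hc : ContinuousAt G ((1 : ℝ) : ℂ) := (hGdiff (by simp; linarith)).continuousAt
    have := (hc.comp continuous_ofReal.continuousAt).tendsto.mono_left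
      (nhdsWithin_le_nhds (s := Iio 1))
    simpa only [Function.comp_def, ofReal_one] using this
  have := tendsto_nhds_unique (hlim.congr' ?_) hG1
  · simpa [hG] using this
  · filter_upwards [Ioo_mem_nhdsLT (zero_lt_one' ℝ)] with t ht
    exact heq t ht

end Laplace

/-! ### Gaussian sums over shifted lattices -/

/-- Bounds the quadratic form below by a diagonal one, so that Gaussian sums factor. The `4`
combines `m² + n² ≤ 2N²`, with `N` the sup norm, and `(a+b)² ≤ 2(a²+b²)`. -/
lemma sq_add_sq_le_norm_sq_add_latticePoint (τ : ℍ) (w : ℂ) (p : ℤ × ℤ) :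
    EisensteinSeries.r τ ^ 2 / 4 * ((p.1 : ℝ) ^ 2 + (p.2 : ℝ) ^ 2) ≤
      ‖w + latticePoint τ p‖ ^ 2 + ‖w‖ ^ 2 := by
  obtain ⟨m, n⟩ := p
  have hr := EisensteinSeries.r_pos τ
  rcases eq_or_ne (![m, n] : Fin 2 → ℤ) 0 with h0 | h0
  · have h1 : m = 0 := by simpa using congrFun h0 0
    have h2 : n = 0 := by simpa using congrFun h0 1
    subst h1 h2
    simp
    positivity
  have h := EisensteinSeries.r_mul_max_le τ h0
  set N := ‖(![m, n] : Fin 2 → ℤ)‖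
  have hm : (m : ℝ) ^ 2 ≤ N ^ 2 := sq_le_sq.mpr (by
    rw [abs_of_nonneg (norm_nonneg (![m, n] : Fin 2 → ℤ))]
    simpa [Int.norm_eq_abs] using norm_le_pi_norm (![m, n] : Fin 2 → ℤ) 0)
  have hn : (n : ℝ) ^ 2 ≤ N ^ 2 := sq_le_sq.mpr (by
    rw [abs_of_nonneg (norm_nonneg (![m, n] : Fin 2 → ℤ))]
    simpa [Int.norm_eq_abs] using norm_le_pi_norm (![m, n] : Fin 2 → ℤ) 1)
  have hlp : ‖latticePoint τ (m, n)‖ ≤ ‖w + latticePoint τ (m, n)‖ + ‖w‖ := by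
    simpa using norm_sub_le (w + latticePoint τ (m, n)) w
  have hle : EisensteinSeries.r τ * N ≤ ‖w + latticePoint τ (m, n)‖ + ‖w‖ := by
    refine le_trans ?_ hlp
    simpa [latticePoint] using h
  have hsq : (EisensteinSeries.r τ * N) ^ 2 ≤ (‖w + latticePoint τ (m, n)‖ + ‖w‖) ^ 2 :=
    pow_le_pow_left₀ (by positivity) hle 2
  calc EisensteinSeries.r τ ^ 2 / 4 * ((m : ℝ) ^ 2 + (n : ℝ) ^ 2)
      ≤ EisensteinSeries.r τ ^ 2 / 4 * (N ^ 2 + N ^ 2) := by gcongr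
    _ = (EisensteinSeries.r τ * N) ^ 2 / 2 := by ring
    _ ≤ _ := by nlinarith [sq_nonneg (‖w + latticePoint τ (m, n)‖ - ‖w‖)]

lemma summable_exp_neg_mul_int_sq {β : ℝ} (hβ : 0 < β) :
    Summable fun n : ℤ => Real.exp (-(β * (n : ℝ) ^ 2)) := by
  refine (summable_pow_mul_jacobiTheta₂_term_bound 0 (div_pos hβ Real.pi_pos) 0).congr
    fun n => ?_
  rw [pow_zero, one_mul]
  congr 1
  field_simp
  ring

/-- Gaussian sums over a shifted lattice converge. -/
lemma summable_exp_neg_mul_norm_sq (τ : ℍ) (w : ℂ) {α : ℝ} (hα : 0 < α) :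
    Summable fun p : ℤ × ℤ => Real.exp (-(α * ‖w + latticePoint τ p‖ ^ 2)) := by
  have hβ : 0 < α * (EisensteinSeries.r τ ^ 2 / 4) := by
    have := EisensteinSeries.r_pos τ
    positivity
  have h := summable_exp_neg_mul_int_sq hβ
  refine Summable.of_nonneg_of_le (fun p => (Real.exp_pos _).le) (fun p => ?_)
    ((h.mul_of_nonneg h (fun n => (Real.exp_pos _).le)
      (fun n => (Real.exp_pos _).le)).mul_left (Real.exp (α * ‖w‖ ^ 2)))
  rw [← Real.exp_add, ← Real.exp_add, Real.exp_le_exp]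
  have := mul_le_mul_of_nonneg_left (sq_add_sq_le_norm_sq_add_latticePoint τ w p) hα.le
  linarith

lemma finite_norm_sq_add_latticePoint_le (τ : ℍ) (w : ℂ) (M : ℝ) :
    {p : ℤ × ℤ | ‖w + latticePoint τ p‖ ^ 2 ≤ M}.Finite := by
  have h := (summable_exp_neg_mul_norm_sq τ w one_pos).tendsto_cofinite_zero.eventually
    (gt_mem_nhds (Real.exp_pos (-M)))
  refine (Filter.eventually_cofinite.mp h).subset fun p hp => ?_
  simpa using hp

/-- The nonzero points of a shifted lattice are bounded away from any strict lower bound. -/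
lemma exists_gt_forall_le_norm_sq (τ : ℍ) (w : ℂ) {M : ℝ}
    (hM : ∀ p : ℤ × ℤ, w + latticePoint τ p ≠ 0 → M < ‖w + latticePoint τ p‖ ^ 2) :
    ∃ m > M, ∀ p : ℤ × ℤ, w + latticePoint τ p ≠ 0 → m ≤ ‖w + latticePoint τ p‖ ^ 2 := by
  set F : Set (ℤ × ℤ) := {p | ‖w + latticePoint τ p‖ ^ 2 ≤ M + 1 ∧ w + latticePoint τ p ≠ 0}
  have hF : F.Finite := (finite_norm_sq_add_latticePoint_le τ w (M + 1)).subset fun p hp => hp.1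
  rcases F.eq_empty_or_nonempty with h | h
  · refine ⟨M + 1, lt_add_one M, fun p hp => ?_⟩
    by_contra! hlt
    exact (h ▸ (⟨hlt.le, hp⟩ : p ∈ F) : p ∈ (∅ : Set (ℤ × ℤ)))
  · obtain ⟨p₀, hp₀, hmin⟩ := exists_min_image F (fun p => ‖w + latticePoint τ p‖ ^ 2) hF h
    refine ⟨_, hM p₀ hp₀.2, fun p hp => ?_⟩
    rcases le_or_gt (‖w + latticePoint τ p‖ ^ 2) (M + 1) with hle | hgt
    · exact hmin p ⟨hle, hp⟩
    · exact hp₀.1.trans hgt.le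

/-! ### Continuity and decay of the theta sums -/

lemma norm_phase (τ : ℍ) (u v : ℂ) : ‖phase τ u v‖ = 1 := by
  rw [phase, show (2 * (Real.pi : ℂ) * I / (τ.im : ℂ) * ((u * (starRingEnd ℂ) v).im : ℂ)) =
    ((2 * Real.pi / τ.im * (u * (starRingEnd ℂ) v).im : ℝ) : ℂ) * I by push_cast; ring]
  exact norm_exp_ofReal_mul_I _

lemma norm_thetaSum_term (τ : ℍ) (w z : ℂ) (x : ℝ) (p : ℤ × ℤ) :
    ‖cexp ((-(Real.pi * x / τ.im * ‖w + latticePoint τ p‖ ^ 2) : ℝ) : ℂ)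
      * phase τ (w + latticePoint τ p) z‖ =
    Real.exp (-(Real.pi * x / τ.im * ‖w + latticePoint τ p‖ ^ 2)) := by
  rw [norm_mul, norm_phase, mul_one, norm_exp, ofReal_re]

lemma continuousOn_thetaSum (τ : ℍ) (w z : ℂ) : ContinuousOn (thetaSum τ w z) (Ioi 1) := by
  have hτ := τ.im_pos
  refine continuousOn_tsum (fun p => ?_) ((summable_exp_neg_mul_norm_sq τ w
    (div_pos Real.pi_pos hτ)).subtype {p | w + latticePoint τ p ≠ 0}) fun p x hx => ?_
  · fun_prop
  · rw [norm_thetaSum_term, Function.comp_apply, Real.exp_le_exp, neg_le_neg_iff]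
    gcongr
    exact le_mul_of_one_le_right Real.pi_pos.le (le_of_lt hx)

/-- Exponential decay of the theta sum, with the rate given by the smallest nonzero norm. -/
lemma exists_norm_thetaSum_le (τ : ℍ) (w z : ℂ) {m : ℝ}
    (hm : ∀ p : ℤ × ℤ, w + latticePoint τ p ≠ 0 → m ≤ ‖w + latticePoint τ p‖ ^ 2) :
    ∃ C : ℝ, ∀ x ∈ Ioi (1 : ℝ),
      ‖thetaSum τ w z x‖ ≤ C * Real.exp (-(Real.pi / τ.im * m) * x) := by
  have hτ := τ.im_pos
  -- As `x > 1`, the weight `1/2` of the exponent is kept for summability and `x - 1/2 > 0` is spent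
  -- on the lower bound `m`.
  have hα : 0 < Real.pi / τ.im * (1 / 2) := by positivity
  have hs : Summable fun p : {p : ℤ × ℤ // w + latticePoint τ p ≠ 0} =>
      Real.exp (-(Real.pi / τ.im * (1 / 2) * ‖w + latticePoint τ p.1‖ ^ 2)) :=
    (summable_exp_neg_mul_norm_sq τ w hα).subtype {p | w + latticePoint τ p ≠ 0}
  refine ⟨Real.exp (Real.pi / τ.im * (1 / 2) * m) * ∑' p : {p : ℤ × ℤ // w + latticePoint τ p ≠ 0},
    Real.exp (-(Real.pi / τ.im * (1 / 2) * ‖w + latticePoint τ p.1‖ ^ 2)), fun x hx => ?_⟩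
  have hx : 1 < x := hx
  rw [mul_right_comm, ← Real.exp_add, ← tsum_mul_left]
  refine tsum_of_norm_bounded (hs.mul_left _).hasSum fun p => ?_
  rw [norm_thetaSum_term, ← Real.exp_add, Real.exp_le_exp]
  have h := mul_le_mul_of_nonneg_left (hm p.1 p.2)
    (show 0 ≤ Real.pi / τ.im * (x - 1 / 2) from mul_nonneg (by positivity) (by linarith))
  linear_combination h

/-! ### Lattice translations -/

section Quasiperiodicity

variable (τ : ℍ)

lemma phase_add_left (u u' v : ℂ) : phase τ (u + u') v = phase τ u v * phase τ u' v := by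
  rw [phase, phase, phase, ← Complex.exp_add, add_mul, add_im]
  push_cast
  ring_nf

lemma phase_add_right (u v v' : ℂ) : phase τ u (v + v') = phase τ u v * phase τ u v' := by
  rw [phase, phase, phase, ← Complex.exp_add, map_add, mul_add, add_im]
  push_cast
  ring_nf

lemma phase_mul_phase_swap (u v : ℂ) : phase τ u v * phase τ v u = 1 := by
  rw [phase, phase, ← Complex.exp_add, ← mul_add, ← ofReal_add]
  simp
  ring_nf
  simp

lemma phase_eq_exp (A B : ℝ) (p : ℤ × ℤ) :
    phase τ ((A : ℂ) * τ + B) (latticePoint τ p) =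
      cexp (2 * (Real.pi : ℂ) * I * (A * p.2 - B * p.1)) := by
  have hτ : (τ.im : ℂ) ≠ 0 := by exact_mod_cast τ.im_ne_zero
  have h : (((A : ℂ) * τ + B) * (starRingEnd ℂ) (latticePoint τ p)).im =
      τ.im * (A * p.2 - B * p.1) := by
    simp [latticePoint]
    ring
  rw [phase, h]
  congr 1
  push_cast
  field_simp

lemma phase_latticePoint_latticePoint (p q : ℤ × ℤ) :
    phase τ (latticePoint τ p) (latticePoint τ q) = 1 := by
  have h := phase_eq_exp τ p.1 p.2 q
  push_cast at h
  rw [show latticePoint τ p = (p.1 : ℂ) * τ + p.2 from rfl, h, Complex.exp_eq_one_iff]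
  exact ⟨p.1 * q.2 - p.2 * q.1, by push_cast; ring⟩

lemma thetaSum_add_latticePoint_left (w z : ℂ) (q : ℤ × ℤ) (x : ℝ) :
    thetaSum τ (w + latticePoint τ q) z x = thetaSum τ w z x := by
  have hshift (p : ℤ × ℤ) : w + latticePoint τ q + latticePoint τ p =
      w + latticePoint τ (Equiv.addLeft q p) := by
    simp only [latticePoint, Equiv.coe_addLeft, Prod.fst_add, Prod.snd_add]
    push_cast
    ring
  let e : {p : ℤ × ℤ // w + latticePoint τ q + latticePoint τ p ≠ 0} ≃
      {p : ℤ × ℤ // w + latticePoint τ p ≠ 0} :=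
    (Equiv.addLeft q).subtypeEquiv fun p => by rw [hshift]
  rw [thetaSum, thetaSum, ← e.tsum_eq]
  refine tsum_congr fun p => ?_
  rw [hshift]
  rfl

lemma thetaSum_add_latticePoint_right (w z : ℂ) (q : ℤ × ℤ) (x : ℝ) :
    thetaSum τ w (z + latticePoint τ q) x = phase τ w (latticePoint τ q) * thetaSum τ w z x := by
  rw [thetaSum, thetaSum, ← tsum_mul_left]
  refine tsum_congr fun p => ?_
  rw [phase_add_right, phase_add_left τ w _ (latticePoint τ q), phase_latticePoint_latticePoint]
  ring

/-- In the first half the factor comes from the prefactor, the theta sum being periodic in its first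
point; in the second it comes from the theta sum. -/
lemma kroneckerE_add_latticePoint (s w z : ℂ) (q : ℤ × ℤ) :
    kroneckerE s w (z + latticePoint τ q) τ =
      phase τ w (latticePoint τ q) * kroneckerE s w z τ := by
  simp only [kroneckerE, thetaSum_add_latticePoint_left, thetaSum_add_latticePoint_right,
    phase_add_right, mul_left_comm _ (phase τ w (latticePoint τ q)), integral_const_mul]
  ring

lemma massiveE_add_latticePoint (c μ : ℝ) (w z : ℂ) (q : ℤ × ℤ) :
    massiveE c μ w (z + latticePoint τ q) τ =
      phase τ w (latticePoint τ q) * massiveE c μ w z τ := by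
  simp only [massiveE, mellinInv, mellinKernel, kroneckerE_add_latticePoint, smul_eq_mul,
    mul_left_comm _ (phase τ w (latticePoint τ q)), integral_const_mul, mul_smul_comm]

lemma isQuasiperiodic_massiveE (c μ : ℝ) :
    IsQuasiperiodic fun w z τ => massiveE c μ w z τ := by
  rintro τ w z A B rfl
  constructor
  · have h := massiveE_add_latticePoint τ c μ ((A : ℂ) * τ + B) z (0, 1)
    rw [phase_eq_exp] at h
    simpa [latticePoint] using h
  · have h := massiveE_add_latticePoint τ c μ ((A : ℂ) * τ + B) z (1, 0)
    rw [phase_eq_exp] at h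
    simpa [latticePoint] using h

end Quasiperiodicity

/-! ### The two halves as Mellin-type integrals and moments -/

lemma integrableOn_mul_cpow {a : ℝ → ℂ} {C m : ℝ}
    (ha : AEStronglyMeasurable a (volume.restrict (Ioi 1)))
    (hC : ∀ x ∈ Ioi (1 : ℝ), ‖a x‖ ≤ C * Real.exp (-m * x)) (hm : 0 < m) (r : ℝ) :
    IntegrableOn (fun x => a x * (x : ℂ) ^ (r : ℂ)) (Ioi 1) := by
  have h : IntegrableOn (fun x : ℝ => C * (x ^ |r| * Real.exp (-m * x))) (Ioi 1) := by
    have h0 := integrableOn_rpow_mul_exp_neg_mul_rpow (s := |r|)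
      (by linarith [abs_nonneg r]) one_pos hm
    simp only [Real.rpow_one] at h0
    exact (h0.mono_set (Ioi_subset_Ioi zero_le_one)).const_mul C
  refine h.mono' (ha.mul (Measurable.aestronglyMeasurable (by fun_prop))) ?_
  filter_upwards [ae_restrict_mem measurableSet_Ioi] with x hx
  have hx : 1 < x := hx
  rw [norm_mul, norm_cpow_eq_rpow_re_of_pos (one_pos.trans hx), ofReal_re]
  calc ‖a x‖ * x ^ r ≤ (C * Real.exp (-m * x)) * x ^ |r| :=
        mul_le_mul (hC x hx) (Real.rpow_le_rpow_of_exponent_le hx.le (le_abs_self r))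
          (by positivity) ((norm_nonneg _).trans (hC x hx))
    _ = _ := by ring

lemma aestronglyMeasurable_thetaSum (τ : ℍ) (w z : ℂ) :
    AEStronglyMeasurable (thetaSum τ w z) (volume.restrict (Ioi 1)) :=
  (continuousOn_thetaSum τ w z).aestronglyMeasurable measurableSet_Ioi

lemma aestronglyMeasurable_inv_mul_thetaSum (τ : ℍ) (w z : ℂ) :
    AEStronglyMeasurable (fun x : ℝ => (x : ℂ)⁻¹ * thetaSum τ w z x)
      (volume.restrict (Ioi 1)) :=
  (Measurable.aestronglyMeasurable (by fun_prop)).mul (aestronglyMeasurable_thetaSum τ w z)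

lemma norm_inv_mul_le {a : ℂ} {x : ℝ} (hx : 1 < x) : ‖(x : ℂ)⁻¹ * a‖ ≤ ‖a‖ := by
  rw [norm_mul, norm_inv, norm_real, Real.norm_of_nonneg (by linarith)]
  exact mul_le_of_le_one_left (norm_nonneg _) (inv_le_one_of_one_le₀ hx.le)

lemma exists_norm_thetaSum_le_exp (τ : ℍ) (w z : ℂ) :
    ∃ C m : ℝ, 0 < m ∧ ∀ x ∈ Ioi (1 : ℝ), ‖thetaSum τ w z x‖ ≤ C * Real.exp (-m * x) := by
  obtain ⟨m, hm, hle⟩ := exists_gt_forall_le_norm_sq τ w (M := 0) fun p hp => by positivity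
  obtain ⟨C, hC⟩ := exists_norm_thetaSum_le τ w z hle
  have hτ := τ.im_pos
  exact ⟨C, Real.pi / τ.im * m, mul_pos (by positivity) hm, hC⟩

/-- Puts both halves in the form `∫ a b^{-s}` required for Mellin inversion. -/
lemma kroneckerE_add_one (s w z : ℂ) (τ : ℍ) :
    kroneckerE (s + 1) w z τ =
      phase τ w z * (∫ x in Ioi (1 : ℝ), ((x : ℂ)⁻¹ * thetaSum τ z w x) * (x : ℂ) ^ (-s)) +
        ∫ x in Ioi (1 : ℝ), thetaSum τ w z x * ((x⁻¹ : ℝ) : ℂ) ^ (-s) := by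
  rw [kroneckerE]
  refine congrArg₂ (· + ·) (congrArg (phase τ w z * ·) ?_) ?_
  · refine setIntegral_congr_fun measurableSet_Ioi fun x hx => ?_
    have hx0 : (x : ℂ) ≠ 0 := by exact_mod_cast (one_pos.trans hx).ne'
    rw [neg_add, cpow_add _ _ hx0, cpow_neg_one]
    ring
  · refine setIntegral_congr_fun measurableSet_Ioi fun x hx => ?_
    have hx0 : 0 < x := one_pos.trans hx
    rw [add_sub_cancel_right, ofReal_inv, inv_cpow _ _ (by
      rw [arg_ofReal_of_nonneg hx0.le]; exact Real.pi_pos.ne), cpow_neg, inv_inv, mul_comm]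

lemma kroneckerE_natCast (n : ℕ) (w z : ℂ) (τ : ℍ) :
    kroneckerE n w z τ =
      phase τ w z * (∫ x in Ioi (1 : ℝ), ((x⁻¹ : ℝ) : ℂ) ^ n * thetaSum τ z w x) +
        ∫ x in Ioi (1 : ℝ), (x : ℂ) ^ n * ((x : ℂ)⁻¹ * thetaSum τ w z x) := by
  rw [kroneckerE]
  refine congrArg₂ (· + ·) (congrArg (phase τ w z * ·) ?_) ?_
  · congr 1 with x
    rw [cpow_neg, cpow_natCast, ofReal_inv, inv_pow]
  · refine setIntegral_congr_fun measurableSet_Ioi fun x hx => ?_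
    have hx0 : (x : ℂ) ≠ 0 := by exact_mod_cast (one_pos.trans hx).ne'
    rw [cpow_sub _ _ hx0, cpow_natCast, cpow_one]
    ring

/-! ### Integral formula and power series -/

section Expansion

variable {c μ : ℝ}

lemma massiveIntegrand_integrable_and_massiveE_eq (hc : 0 < c) (hμ : 0 < μ) (w z : ℂ) (τ : ℍ) :
    VerticalIntegrable (massiveIntegrand μ w z τ) c ∧
    massiveE c μ w z τ =
      phase τ w z * (∫ x in Ioi (1 : ℝ), ((x : ℂ)⁻¹ * thetaSum τ z w x) *
          cexp (-((Real.pi * μ : ℝ) : ℂ) * x)) +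
        ∫ x in Ioi (1 : ℝ), thetaSum τ w z x *
          cexp (-((Real.pi * μ : ℝ) : ℂ) * (x⁻¹ : ℝ)) := by
  have hy : 0 < Real.pi * μ := by positivity
  have hpos : ∀ᵐ x ∂(volume.restrict (Ioi (1 : ℝ))), 0 < x :=
    (ae_restrict_mem measurableSet_Ioi).mono fun x hx => one_pos.trans hx
  have hpos' : ∀ᵐ x ∂(volume.restrict (Ioi (1 : ℝ))), 0 < x⁻¹ :=
    hpos.mono fun x hx => inv_pos.mpr hx
  obtain ⟨C₁, m₁, hm₁, hC₁⟩ := exists_norm_thetaSum_le_exp τ z w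
  obtain ⟨C₂, m₂, hm₂, hC₂⟩ := exists_norm_thetaSum_le_exp τ w z
  have h₁ : Integrable (fun x : ℝ => ((x : ℂ)⁻¹ * thetaSum τ z w x) * (x : ℂ) ^ (-(c : ℂ)))
      (volume.restrict (Ioi 1)) := by
    simpa [IntegrableOn] using integrableOn_mul_cpow (aestronglyMeasurable_inv_mul_thetaSum τ z w)
      (fun x hx => (norm_inv_mul_le hx).trans (hC₁ x hx)) hm₁ (-c)
  have h₂ : Integrable (fun x : ℝ => thetaSum τ w z x * ((x⁻¹ : ℝ) : ℂ) ^ (-(c : ℂ)))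
      (volume.restrict (Ioi 1)) := by
    refine (integrableOn_mul_cpow (aestronglyMeasurable_thetaSum τ w z) hC₂ hm₂ c).congr ?_
    filter_upwards [hpos] with x hx
    rw [ofReal_inv, inv_cpow _ _ (by
      rw [arg_ofReal_of_nonneg hx.le]; exact Real.pi_pos.ne), cpow_neg, inv_inv]
  have hi₁ := (integrable_Gamma_mul_integral (b := fun x => x) hc hy measurable_id hpos h₁).const_mul (phase τ w z)
  have hi₂ := integrable_Gamma_mul_integral hc hy measurable_inv hpos' h₂
  have hsplit (s : ℂ) : massiveIntegrand μ w z τ s =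
      phase τ w z * (((Real.pi * μ : ℝ) : ℂ) ^ (-s) * (Gamma s *
        ∫ x in Ioi (1 : ℝ), ((x : ℂ)⁻¹ * thetaSum τ z w x) * (x : ℂ) ^ (-s))) +
      ((Real.pi * μ : ℝ) : ℂ) ^ (-s) * (Gamma s *
        ∫ x in Ioi (1 : ℝ), thetaSum τ w z x * ((x⁻¹ : ℝ) : ℂ) ^ (-s)) := by
    rw [massiveIntegrand, mellinKernel, kroneckerE_add_one]
    ring
  constructor
  · simp only [VerticalIntegrable, hsplit]
    exact hi₁.add hi₂
  · have he₁ := mellinInv_Gamma_mul_integral (b := fun x => x) hc hy measurable_id hpos h₁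
    have he₂ := mellinInv_Gamma_mul_integral hc hy measurable_inv hpos' h₂
    have hexp (r : ℝ) : cexp (-((Real.pi * μ : ℝ) : ℂ) * r) =
        (Real.exp (-(Real.pi * μ * r)) : ℂ) := by
      push_cast
      ring_nf
    have hE : massiveE c μ w z τ =
        (1 / (2 * Real.pi)) • ∫ t : ℝ, massiveIntegrand μ w z τ (c + t * I) := rfl
    simp only [hexp]
    rw [← he₂, ← he₁, hE]
    simp only [hsplit]
    rw [integral_add hi₁ hi₂, smul_add, integral_const_mul, ← mul_smul_comm]
    rfl

lemma massiveTerm_eq (μ : ℝ) (w z : ℂ) (τ : ℍ) (n : ℕ) :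
    massiveTerm μ w z τ n =
      phase τ z w * ((-((Real.pi * μ : ℝ) : ℂ)) ^ n / (n.factorial : ℂ) *
        ∫ x in Ioi (1 : ℝ), ((x⁻¹ : ℝ) : ℂ) ^ n * thetaSum τ w z x) +
      (-((Real.pi * μ : ℝ) : ℂ)) ^ n / (n.factorial : ℂ) *
        ∫ x in Ioi (1 : ℝ), (x : ℂ) ^ n * ((x : ℂ)⁻¹ * thetaSum τ z w x) := by
  rw [massiveTerm, kroneckerE_natCast]
  push_cast
  ring

/-- Here `b = 1/x ≤ 1`, so the exponential is bounded and no restriction on `u` is needed. -/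
lemma hasSum_inv_pow_thetaSum (w z : ℂ) (τ : ℍ) (u : ℂ) :
    HasSum (fun n : ℕ => u ^ n / (n.factorial : ℂ) *
        ∫ x in Ioi (1 : ℝ), ((x⁻¹ : ℝ) : ℂ) ^ n * thetaSum τ w z x)
      (∫ x in Ioi (1 : ℝ), thetaSum τ w z x * cexp (u * (x⁻¹ : ℝ))) := by
  obtain ⟨C, m, hm, hC⟩ := exists_norm_thetaSum_le_exp τ w z
  have ha := aestronglyMeasurable_thetaSum τ w z
  refine hasSum_integral_pow ha measurable_inv ?_ ?_
  · exact (ae_restrict_mem measurableSet_Ioi).mono fun x hx =>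
      (inv_pos.mpr (one_pos.trans hx)).le
  · have h0 := integrableOn_norm_mul_exp ha hC hm
    refine (h0.mul_const (Real.exp ‖u‖)).mono'
      (ha.norm.mul (Measurable.aestronglyMeasurable (by fun_prop))) ?_
    filter_upwards [ae_restrict_mem measurableSet_Ioi] with x hx
    rw [Real.norm_of_nonneg (by positivity), zero_mul, Real.exp_zero, mul_one]
    gcongr
    exact mul_le_of_le_one_right (norm_nonneg _) (inv_le_one_of_one_le₀ (le_of_lt hx))

lemma summable_massiveTerm (hμ : 0 < μ) (w z : ℂ) (τ : ℍ)
    (h : ∀ p : ℤ × ℤ, z + latticePoint τ p ≠ 0 → μ * τ.im < ‖z + latticePoint τ p‖ ^ 2) :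
    Summable (massiveTerm μ w z τ) := by
  obtain ⟨m, hm, hle⟩ := exists_gt_forall_le_norm_sq τ z h
  obtain ⟨C, hC⟩ := exists_norm_thetaSum_le τ z w hle
  have hτ := τ.im_pos
  -- The smallness hypothesis on `μ` says exactly that `πμ` lies below the theta decay rate.
  have hlt : ‖-((Real.pi * μ : ℝ) : ℂ)‖ < Real.pi / τ.im * m := by
    rw [norm_neg, norm_real, Real.norm_of_nonneg (by positivity), div_mul_eq_mul_div,
      lt_div_iff₀ hτ, mul_assoc]
    gcongr
  have ha := aestronglyMeasurable_inv_mul_thetaSum τ z w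
  have h₁ := hasSum_integral_pow (b := fun x => x) ha measurable_id
    ((ae_restrict_mem measurableSet_Ioi).mono fun x hx => (one_pos.trans hx).le)
    (integrableOn_norm_mul_exp ha (fun x hx => (norm_inv_mul_le hx).trans (hC x hx)) hlt)
  exact ((((hasSum_inv_pow_thetaSum w z τ _).summable.mul_left _).add h₁.summable).congr
    fun n => (massiveTerm_eq μ w z τ n).symm)

lemma massiveE_eq_of_tendsto (hc : 0 < c) (hμ : 0 < μ) (w z : ℂ) (τ : ℍ) {S : ℂ}
    (hS : Tendsto (fun N : ℕ => ∑ n ∈ Finset.range N, massiveTerm μ w z τ n) atTop (𝓝 S)) :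
    massiveE c μ w z τ = phase τ w z * S := by
  obtain ⟨C, m, hm, hC⟩ := exists_norm_thetaSum_le_exp τ z w
  have h₂ := ((hasSum_inv_pow_thetaSum w z τ
    (-((Real.pi * μ : ℝ) : ℂ))).mul_left (phase τ z w)).tendsto_sum_nat
  -- Removing the unconditionally convergent half leaves a pure Laplace-transform Taylor series.
  have h₁ := hS.sub h₂
  simp only [← Finset.sum_sub_distrib, massiveTerm_eq, add_sub_cancel_left] at h₁
  have key := eq_integral_of_tendsto_sum (aestronglyMeasurable_inv_mul_thetaSum τ z w)
    (fun x hx => (norm_inv_mul_le hx).trans (hC x hx)) hm (mul_pos Real.pi_pos hμ) h₁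
  rw [(massiveIntegrand_integrable_and_massiveE_eq hc hμ w z τ).2, ← key, mul_sub, ← mul_assoc,
    phase_mul_phase_swap, one_mul, sub_add_cancel]

end Expansion

end KroneckerEisenstein

theorem proposition4p2 (c μ : ℝ) (hc : 0 < c) (hμ : 0 < μ) :
    (∀ (w z : ℂ) (τ : ℍ),
      -- the contour integral converges absolutely
      Complex.VerticalIntegrable (KroneckerEisenstein.massiveIntegrand μ w z τ) c ∧
      -- the expansion, with absolute convergence, for small `μ`
      ((∀ p : ℤ × ℤ, z + KroneckerEisenstein.latticePoint τ p ≠ 0 →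
          μ * τ.im < ‖z + KroneckerEisenstein.latticePoint τ p‖ ^ 2) →
        Summable (KroneckerEisenstein.massiveTerm μ w z τ) ∧
        KroneckerEisenstein.massiveE c μ w z τ =
          KroneckerEisenstein.phase τ w z *
            ∑' n : ℕ, KroneckerEisenstein.massiveTerm μ w z τ n) ∧
      -- the expansion for every `μ` at which the series converges, even conditionally
      (∀ S : ℂ,
        Filter.Tendsto
          (fun N : ℕ => ∑ n ∈ Finset.range N, KroneckerEisenstein.massiveTerm μ w z τ n)
          Filter.atTop (nhds S) →
        KroneckerEisenstein.massiveE c μ w z τ = KroneckerEisenstein.phase τ w z * S)) ∧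
    KroneckerEisenstein.IsQuasiperiodic
      (fun w z τ => KroneckerEisenstein.massiveE c μ w z τ) := by
  refine ⟨fun w z τ => ⟨?_, fun h => ?_, fun S hS => ?_⟩, ?_⟩
  · exact (KroneckerEisenstein.massiveIntegrand_integrable_and_massiveE_eq hc hμ w z τ).1
  · have hs := KroneckerEisenstein.summable_massiveTerm hμ w z τ h
    exact ⟨hs, KroneckerEisenstein.massiveE_eq_of_tendsto hc hμ w z τ hs.hasSum.tendsto_sum_nat⟩
  · exact KroneckerEisenstein.massiveE_eq_of_tendsto hc hμ w z τ hS
  · exact KroneckerEisenstein.isQuasiperiodic_massiveE c μ
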